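/- **Model.** An $n$-node network consists of a simple graph $G=(V,E)$ with $|V|=n$, a number $N\ge n$ known to all nodes, distinct identifiers $\mathsf{id}:V\to[1,N]$, and an arbitrary numbering (ports) of the neighbours of each node. All nodes run the same deterministic algorithm in synchronous rounds, starting simultaneously. Initially a node knows $N$, its identifier, its degree (ports) and its input; local computation is unrestricted. In each round every non-terminated node may send a (possibly different) bit string, or nothing, to each of its neighbours, receives the messages that its neighbours sent in this round, and updates its state; at some point it terminates with an output. A node is *active* in a round if it sends a message to at least one neighbour in that round; the *node-activation* of an execution is the maximum over the nodes $v$ of the number of rounds in which $v$ is active, and the *node-activation complexity* of an algorithm on a set of instances is the supremum of its node-activation over these instances. In the CONGEST model all messages have $O(\log n)$ bits, and $N$ is polynomially bounded in $n$. **Problem.** In *Depth First Pointer Chasing*, each node $v$ of an $n$-node (connected) graph is given its index $\mathrm{DFS}(v)\in[n]$ in a depth-first search ordering of the graph; the node of index $i$ is moreover given a function $f_i:[n]\to[n]$, and the root (index $1$) is given a value $x\in[n]$. The root has to output $f_n\circ f_{n-1}\circ\dots\circ f_1(x)$. **Theorem.** Let $C,B$ be real constants, and let $p,q$ be polynomials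 with non-negative integer coefficients such that $q(n)\ge n$ for all $n$. Instances are understood to satisfy $N\le q(n)$. 1. There are $c>0$ and $n_0$, depending only on $C,B,p,q$, such that for all $n\ge n_0$ and all integers $\Delta$ with $2\le\Delta\le C\,(n/\log n)^{1/4}$, every algorithm that solves Depth First Pointer Chasing on all $n$-node instances of maximum degree $\Delta$ in at most $p(n)$ rounds, with messages of at most $B\log n$ bits, has node-activation complexity at least $c\,\Delta$ on these instances. That is, for every $\Delta\in O\big((n/\log n)^{1/4}\big)$, every CONGEST algorithm solving the problem in graphs of maximum degree $\Delta$ in polynomially many rounds has node-activation complexity $\Omega(\Delta)$. 2. In particular, there are $c>0$ and $n_0$, depending only on $B,p,q$, such that for all $n\ge n_0$ every algorithm that solves Depth First Pointer Chasing on all $n$-node instances in at most $p(n)$ rounds, with messages of at most $B\log n$ bits, has node-activation complexity at least $c\,(n/\log n)^{1/4}$, hence $\tilde\Omega(n^{1/4})$. -/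

import Mathlib

/-- An `n`-node network: a simple graph on `Fin n`, distinct identifiers in `[1, N]`, where `N ≥ n`
is the bound known to all nodes, and an arbitrary numbering of the neighbours of every node by
local ports. The vertex names `Fin n` themselves are never visible to the nodes. -/
structure Network (n : ℕ) where
  graph : SimpleGraph (Fin n)
  [decAdj : DecidableRel graph.Adj]
  N : ℕ
  le_N : n ≤ N
  id : Fin n → ℕ
  id_injective : Function.Injective id
  id_pos : ∀ v, 1 ≤ id v
  id_le : ∀ v, id v ≤ N
  ports : ∀ v, Fin (graph.degree v) ≃ graph.neighborSet v

attribute [instance] Network.decAdj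

/-- A message is a bit string. -/
abbrev Msg : Type := List Bool

/-- A deterministic synchronous message-passing algorithm, run by all nodes, with inputs in `α` and
outputs in `β`. Local computation is unrestricted. -/
structure Algorithm (α β : Type) where
  /-- local states -/
  State : Type
  /-- initial state of a node, from the bound `N`, its identifier, its degree and its input -/
  init : (N id degree : ℕ) → α → State
  /-- the message (if any) that a node of degree `d` sends on each of its ports -/
  send : (d : ℕ) → State → Fin d → Option Msg
  /-- the new state of a node of degree `d`, from what it received on each of its ports -/
  receive : (d : ℕ) → State → (Fin d → Option Msg) → State
  /-- `some y` when the node has terminated with output `y` -/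
  output : State → Option β

namespace Algorithm

variable {α β : Type} {n : ℕ}

/-- What a node of degree `d` in state `s` sends on each port; a terminated node sends nothing. -/
def outbox (A : Algorithm α β) (d : ℕ) (s : A.State) : Fin d → Option Msg :=
  fun i => if (A.output s).isSome then none else A.send d s i

/-- The state of every node after `t` rounds, on network `G` with inputs `x`. In each round, every
node sends messages depending on its current state, receives the messages that its neighbours sent
to it in that round, and updates its state. Terminated nodes do not change any more. -/
def config (A : Algorithm α β) (G : Network n) (x : Fin n → α) : ℕ → Fin n → A.State
  | 0, v => A.init G.N (G.id v) (G.graph.degree v) (x v)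
  | t + 1, v =>
    if (A.output (A.config G x t v)).isSome then A.config G x t v
    else A.receive (G.graph.degree v) (A.config G x t v) fun i =>
      A.outbox (G.graph.degree (G.ports v i).1) (A.config G x t (G.ports v i).1)
        ((G.ports (G.ports v i).1).symm ⟨v, (G.ports v i).2.symm⟩)

/-- The messages that `v` sends in round `t + 1` (rounds are numbered from 1). -/
def sent (A : Algorithm α β) (G : Network n) (x : Fin n → α) (t : ℕ) (v : Fin n) :
    Fin (G.graph.degree v) → Option Msg :=
  A.outbox (G.graph.degree v) (A.config G x t v)

/-- All nodes have terminated after at most `T` rounds. -/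
def HaltsBy (A : Algorithm α β) (G : Network n) (x : Fin n → α) (T : ℕ) : Prop :=
  ∀ v, (A.output (A.config G x T v)).isSome

/-- Every message sent during the execution has at most `b` bits. -/
def MessagesBoundedBy (A : Algorithm α β) (G : Network n) (x : Fin n → α) (b : ℝ) : Prop :=
  ∀ t v i m, A.sent G x t v i = some m → (m.length : ℝ) ≤ b

/-- Node `v` is active in round `t + 1`: it sends a message to at least one neighbour. -/
def Active (A : Algorithm α β) (G : Network n) (x : Fin n → α) (t : ℕ) (v : Fin n) : Prop :=
  ∃ i, (A.sent G x t v i).isSome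

/-- The node-activation of one execution: the maximum over all nodes `v` of the number of rounds in
which `v` is active. -/
noncomputable def nact (A : Algorithm α β) (G : Network n) (x : Fin n → α) : ℕ∞ :=
  ⨆ v : Fin n, {t : ℕ | A.Active G x t v}.encard

end Algorithm

/-- `d` (vertex ↦ index, indices starting at `0`) is the order in which a depth-first search
discovers the vertices of `G`: after the vertices of index `≤ i` have been discovered, the next one
is an undiscovered neighbour of the most recently discovered vertex (index `j`) that still has
undiscovered neighbours. In particular `G` is connected. -/
def IsDFSOrdering {n : ℕ} (G : SimpleGraph (Fin n)) (d : Fin n ≃ Fin n) : Prop :=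
  ∀ i i' : Fin n, i'.val = i.val + 1 →
    ∃ j ≤ i, G.Adj (d.symm j) (d.symm i') ∧
      ∀ l, j < l → l ≤ i → ∀ m, i < m → ¬ G.Adj (d.symm l) (d.symm m)

/-- The input of one node in Depth First Pointer Chasing; `[n]` is represented by `Fin n`. -/
structure DFPCInput where
  n : ℕ
  /-- the index of the node in the depth-first ordering -/
  index : Fin n
  /-- the function of the node -/
  func : Fin n → Fin n
  /-- the starting value, given to the root only -/
  start : Option (Fin n)

/-- An instance of Depth First Pointer Chasing on `n` nodes. -/
structure DFPCInstance (n : ℕ) extends Network n where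
  dfs : Fin n ≃ Fin n
  isDFS : IsDFSOrdering graph dfs
  /-- the function given to each vertex -/
  func : Fin n → Fin n → Fin n
  /-- the starting value -/
  start : Fin n

namespace DFPCInstance

variable {n : ℕ}

/-- The input given to each node: index and function, and for the root the starting value. -/
def input (I : DFPCInstance n) (v : Fin n) : DFPCInput where
  n := n
  index := I.dfs v
  func := I.func v
  start := if (I.dfs v).val = 0 then some I.start else none

/-- `fₙ ∘ ⋯ ∘ f₂ ∘ f₁` applied to the starting value, where `fᵢ` is the function of the `i`-th vertex
in the depth-first ordering. -/
def value (I : DFPCInstance n) : Fin n :=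
  (List.finRange n).foldl (fun y i => I.func (I.dfs.symm i) y) I.start

end DFPCInstance

/-- Algorithm `A` solves the instance `I`: all nodes terminate, and the root outputs the value of
the instance. Values are output as numbers. -/
def SolvesDFPC (A : Algorithm DFPCInput ℕ) {n : ℕ} (I : DFPCInstance n) : Prop :=
  ∃ T, A.HaltsBy I.toNetwork I.input T ∧
    ∀ v, (I.dfs v).val = 0 → A.output (A.config I.toNetwork I.input T v) = some I.value.val

/-- All `n`-node instances whose identifiers and bound `N` are at most `q n`. -/
def dfpcInstances (q : Polynomial ℕ) (n : ℕ) : Set (DFPCInstance n) :=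
  {I | I.N ≤ q.eval n}

/-- Those among them whose graph has maximum degree `Δ`. -/
def dfpcInstancesOfMaxDegree (q : Polynomial ℕ) (n Δ : ℕ) : Set (DFPCInstance n) :=
  {I | I.N ≤ q.eval n ∧ I.graph.maxDegree = Δ}

/-- On every instance in `S`, algorithm `A` terminates within `T` rounds, sends only messages of at
most `b` bits, and solves Depth First Pointer Chasing. -/
structure SolvesDFPCWithin (A : Algorithm DFPCInput ℕ) {n : ℕ} (S : Set (DFPCInstance n))
    (T : ℕ) (b : ℝ) : Prop where
  rounds : ∀ I ∈ S, A.HaltsBy I.toNetwork I.input T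
  messages : ∀ I ∈ S, A.MessagesBoundedBy I.toNetwork I.input b
  correct : ∀ I ∈ S, SolvesDFPC A I

/-- The node-activation complexity of `A` over a set of instances: the worst case over the set. -/
noncomputable def nodeActivationComplexity (A : Algorithm DFPCInput ℕ) {n : ℕ}
    (S : Set (DFPCInstance n)) : ℕ∞ :=
  ⨆ I ∈ S, A.nact I.toNetwork I.input

/-- The first `L` bits of a message, padded with `none`. -/
def paddedBits (L : ℕ) (m : Msg) : Fin L → Option Bool := fun i => m[i.val]?

theorem paddedBits_injOn {L : ℕ} {m m' : Msg} (hm : m.length ≤ L) (hm' : m'.length ≤ L)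
    (h : paddedBits L m = paddedBits L m') : m = m' := by
  refine List.ext_getElem? fun i => ?_
  by_cases hi : i < L
  · exact congrFun h ⟨i, hi⟩
  · rw [List.getElem?_eq_none (by omega), List.getElem?_eq_none (by omega)]

open Classical in
/-- The first `k` messages of length at most `L` sent before time `T` in the message sequence `σ`,
each with the time at which it is sent. -/
noncomputable def eventCode (T L k : ℕ) (σ : ℕ → Option Msg) :
    Fin k → Option (Fin T × (Fin L → Option Bool)) := fun i =>
  if h : ∃ e : Fin T × (Fin L → Option Bool), ∃ m, σ e.1 = some m ∧ m.length ≤ L ∧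
      Nat.count (fun j => (σ j).isSome) e.1 = i ∧ e.2 = paddedBits L m
  then some h.choose else none

theorem eq_some_of_eventCode_eq {T L k j : ℕ} {σ σ' : ℕ → Option Msg} {m : Msg}
    (h : eventCode T L k σ = eventCode T L k σ') (hj : j < T) (hm : σ j = some m)
    (hL : m.length ≤ L) (hk : Nat.count (fun j => (σ j).isSome) j < k) : σ' j = some m := by
  classical
  have hex : ∃ e : Fin T × (Fin L → Option Bool), ∃ m, σ e.1 = some m ∧ m.length ≤ L ∧
      Nat.count (fun j => (σ j).isSome) e.1 = Nat.count (fun j => (σ j).isSome) j ∧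
      e.2 = paddedBits L m := ⟨(⟨j, hj⟩, paddedBits L m), m, hm, hL, rfl, rfl⟩
  have h1 : eventCode T L k σ ⟨_, hk⟩ = some hex.choose := dif_pos hex
  rw [h] at h1
  have hex' : ∃ e : Fin T × (Fin L → Option Bool), ∃ m, σ' e.1 = some m ∧ m.length ≤ L ∧
      Nat.count (fun j => (σ' j).isSome) e.1 = Nat.count (fun j => (σ j).isSome) j ∧
      e.2 = paddedBits L m := by
    by_contra hne
    have h2 : eventCode T L k σ' ⟨_, hk⟩ = none := dif_neg hne
    simp [h2] at h1
  have h2 : eventCode T L k σ' ⟨_, hk⟩ = some hex'.choose := dif_pos hex'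
  rw [h2, Option.some.injEq] at h1
  obtain ⟨m₁, hm₁, hl₁, hc₁, he₁⟩ := hex.choose_spec
  obtain ⟨m₂, hm₂, hl₂, -, he₂⟩ := hex'.choose_spec
  rw [h1] at hm₂ he₂
  have hjj : (hex.choose.1 : ℕ) = j :=
    Nat.count_injective (by simp [hm₁]) (by simp [hm]) hc₁
  rw [hjj] at hm₁ hm₂
  rw [hm₁, Option.some.injEq] at hm
  rw [hm₂, ← hm, paddedBits_injOn hl₂ hl₁ (he₂.symm.trans he₁)]

theorem eq_of_eventCode_eq {T L k j : ℕ} {σ σ' : ℕ → Option Msg}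
    (h : eventCode T L k σ = eventCode T L k σ') (hj : j < T)
    (hσ : ∀ m, σ j = some m → m.length ≤ L ∧ Nat.count (fun j => (σ j).isSome) j < k)
    (hσ' : ∀ m, σ' j = some m → m.length ≤ L ∧ Nat.count (fun j => (σ' j).isSome) j < k) :
    σ j = σ' j := by
  refine Option.ext fun m => ⟨fun hm => ?_, fun hm => ?_⟩
  · exact eq_some_of_eventCode_eq h hj hm (hσ m hm).1 (hσ m hm).2
  · exact eq_some_of_eventCode_eq h.symm hj hm (hσ' m hm).1 (hσ' m hm).2

/-- If `P` holds at most `k` times, then a sequence that is contained in a shift of `P` up to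
time `j` has fewer than `k` occurrences before its occurrence at time `j`. -/
theorem count_lt_of_encard_le {P Q : ℕ → Prop} [DecidablePred Q] {k t j : ℕ}
    (hP : {s | P s}.encard ≤ k) (hQ : ∀ i ≤ j, Q i → P (t + i)) (hj : Q j) :
    Nat.count Q j < k := by
  have h1 : Nat.count Q (j + 1) = Nat.count Q j + 1 := by simp [Nat.count_succ, hj]
  have h2 : (Nat.count Q (j + 1) : ℕ∞) ≤ k := by
    rw [Nat.count_eq_card_filter_range, ← Set.encard_coe_eq_coe_finsetCard,
      ← (add_right_injective t).encard_image]
    refine (Set.encard_le_encard ?_).trans hP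
    rintro _ ⟨i, hi, rfl⟩
    simp only [Finset.coe_filter, Finset.mem_range, Set.mem_ofPred_eq] at hi
    exact hQ i (by omega) hi.2
  have h3 : Nat.count Q (j + 1) ≤ k := by exact_mod_cast h2
  omega

namespace Algorithm

variable {α β : Type} {n : ℕ}

/-- The state of a node of degree `d` that starts in state `s` and receives nothing for `j`
rounds. -/
def silentRun (A : Algorithm α β) (d : ℕ) (s : A.State) : ℕ → A.State
  | 0 => s
  | j + 1 =>
    if (A.output (A.silentRun d s j)).isSome then A.silentRun d s j
    else A.receive d (A.silentRun d s j) fun _ => none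

/-- What `v` receives in round `t + 1`. -/
def inbox (A : Algorithm α β) (G : Network n) (x : Fin n → α) (t : ℕ) (v : Fin n) :
    Fin (G.graph.degree v) → Option Msg := fun i =>
  A.sent G x t (G.ports v i).1 ((G.ports (G.ports v i).1).symm ⟨v, (G.ports v i).2.symm⟩)

theorem config_succ (A : Algorithm α β) (G : Network n) (x : Fin n → α) (t : ℕ) (v : Fin n) :
    A.config G x (t + 1) v =
      if (A.output (A.config G x t v)).isSome then A.config G x t v
      else A.receive (G.graph.degree v) (A.config G x t v) (A.inbox G x t v) := rfl

theorem config_add_eq_silentRun (A : Algorithm α β) (G : Network n) (x : Fin n → α) {c v : Fin n}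
    (hv : ∀ w, G.graph.Adj v w → w = c) {t j : ℕ}
    (h : ∀ s, t ≤ s → s < t + j → ¬ A.Active G x s c) :
    A.config G x (t + j) v = A.silentRun (G.graph.degree v) (A.config G x t v) j := by
  induction j with
  | zero => rfl
  | succ j ih =>
    have ih := ih fun s hs hs' => h s hs (by omega)
    have hin : A.inbox G x (t + j) v = fun _ => none := by
      funext i
      have hi := hv _ (G.ports v i).2
      by_contra hne
      refine h (t + j) (by omega) (by omega) ?_
      rw [← hi]
      exact ⟨_, Option.isSome_iff_ne_none.2 hne⟩
    rw [← add_assoc, config_succ, hin, ih]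
    rfl

/-- `L` is a set of leaves of `G` that are all adjacent to `c`. -/
structure _root_.Network.LeavesAt (G : Network n) (c : Fin n) (L : Set (Fin n)) : Prop where
  notMem : c ∉ L
  adj : ∀ v ∈ L, G.graph.Adj v c
  eq_center : ∀ v ∈ L, ∀ w, G.graph.Adj v w → w = c

variable {F : Type}

/-- On the box `S` of inputs, the states after `t` rounds are constant outside `L`, and the state of
a node in `L` depends only on its own input. -/
def Synced (A : Algorithm α β) (G : Network n) (h : Fin n → F → α) (L : Set (Fin n))
    (S : Fin n → Finset F) (t : ℕ) : Prop :=
  ∀ f f' : Fin n → F, (∀ v, f v ∈ S v) → (∀ v, f' v ∈ S v) → ∀ v, (v ∉ L ∨ f v = f' v) →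
    A.config G (fun w => h w (f w)) t v = A.config G (fun w => h w (f' w)) t v

/-- The messages that a leaf `v` at `c` in state `s` would send to `c` if `c` were silent. -/
def silentSent (A : Algorithm α β) (G : Network n) {c v : Fin n} (hv : G.graph.Adj v c)
    (s : A.State) (j : ℕ) : Option Msg :=
  A.outbox (G.graph.degree v) (A.silentRun (G.graph.degree v) s j) ((G.ports v).symm ⟨c, hv⟩)

variable {A : Algorithm α β} {G : Network n} {h : Fin n → F → α} {L : Set (Fin n)}
  {S S' : Fin n → Finset F} {c : Fin n} {t T b k : ℕ}

theorem Synced.mono (hS : A.Synced G h L S t) (hSS' : ∀ v, S' v ⊆ S v) : A.Synced G h L S' t :=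
  fun f f' hf hf' => hS f f' (fun v => hSS' v (hf v)) fun v => hSS' v (hf' v)

theorem Synced.succ (hS : A.Synced G h L S t) (hL : G.LeavesAt c L)
    (hsent : ∀ v (hv : v ∈ L), ∀ f f' : Fin n → F, (∀ v, f v ∈ S v) → (∀ v, f' v ∈ S v) →
      A.sent G (fun w => h w (f w)) t v ((G.ports v).symm ⟨c, hL.adj v hv⟩) =
      A.sent G (fun w => h w (f' w)) t v ((G.ports v).symm ⟨c, hL.adj v hv⟩)) :
    A.Synced G h L S (t + 1) := by
  intro f f' hf hf' v hv
  have hin : A.inbox G (fun w => h w (f w)) t v = A.inbox G (fun w => h w (f' w)) t v := by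
    funext i
    suffices ∀ u : G.graph.neighborSet v,
        A.sent G (fun w => h w (f w)) t u.1 ((G.ports u.1).symm ⟨v, u.2.symm⟩) =
        A.sent G (fun w => h w (f' w)) t u.1 ((G.ports u.1).symm ⟨v, u.2.symm⟩) from
      this (G.ports v i)
    rintro ⟨w, hw⟩
    by_cases hwL : w ∈ L
    · obtain rfl := hL.eq_center w hwL v (SimpleGraph.Adj.symm hw)
      exact hsent w hwL f f' hf hf'
    · simp only [sent, hS f f' hf hf' w (Or.inl hwL)]
  rw [config_succ, config_succ, hin, hS f f' hf hf' v hv]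

/-- All executions respect the given bounds on activity and message
length. -/
structure Bounded (A : Algorithm α β) (G : Network n) (h : Fin n → F → α) (k b : ℕ) : Prop where
  activity : ∀ (f : Fin n → F) v, {t | A.Active G (fun w => h w (f w)) t v}.encard ≤ k
  length : ∀ (f : Fin n → F) t v i m, A.sent G (fun w => h w (f w)) t v i = some m → m.length ≤ b

/-- On the box `S`, the leaves behave identically from time `t` on as long as `c` is silent. -/
def SameCode (A : Algorithm α β) (G : Network n) (h : Fin n → F → α) {L : Set (Fin n)} {c : Fin n}
    (hL : G.LeavesAt c L) (T b k : ℕ) (S : Fin n → Finset F) (t : ℕ) : Prop :=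
  ∀ v (hv : v ∈ L), ∀ f f' : Fin n → F, (∀ v, f v ∈ S v) → (∀ v, f' v ∈ S v) →
    eventCode T b k (A.silentSent G (hL.adj v hv) (A.config G (fun w => h w (f w)) t v)) =
    eventCode T b k (A.silentSent G (hL.adj v hv) (A.config G (fun w => h w (f' w)) t v))

theorem silentSent_bounds (hB : A.Bounded G h k b) (hL : G.LeavesAt c L) {v : Fin n} (hv : v ∈ L)
    {f : Fin n → F} {j : ℕ}
    (hj : ∀ s, t ≤ s → s < t + j → ¬ A.Active G (fun w => h w (f w)) s c) {m : Msg}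
    (hm : A.silentSent G (hL.adj v hv) (A.config G (fun w => h w (f w)) t v) j = some m) :
    m.length ≤ b ∧ Nat.count (fun i => (A.silentSent G (hL.adj v hv)
      (A.config G (fun w => h w (f w)) t v) i).isSome) j < k := by
  have hreal : ∀ i ≤ j, A.silentSent G (hL.adj v hv) (A.config G (fun w => h w (f w)) t v) i =
      A.sent G (fun w => h w (f w)) (t + i) v ((G.ports v).symm ⟨c, hL.adj v hv⟩) := by
    intro i hi
    rw [sent, config_add_eq_silentRun A G _ (hL.eq_center v hv) fun s hs hs' =>
      hj s hs (by omega)]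
    rfl
  refine ⟨hB.length f _ v _ m ((hreal j le_rfl).symm.trans hm), ?_⟩
  refine count_lt_of_encard_le (t := t) (hB.activity f v) (fun i hi hi' => ?_) (by simp [hm])
  rw [hreal i hi] at hi'
  exact ⟨_, hi'⟩

theorem Synced.succ_of_silent {j : ℕ} (hB : A.Bounded G h k b) (hL : G.LeavesAt c L)
    (hcode : A.SameCode G h hL T b k S t) (hS : A.Synced G h L S (t + j)) (hT : t + j < T)
    (hj : ∀ f : Fin n → F, (∀ v, f v ∈ S v) →
      ∀ s, t ≤ s → s < t + j → ¬ A.Active G (fun w => h w (f w)) s c) :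
    A.Synced G h L S (t + j + 1) := by
  refine hS.succ hL fun v hv f f' hf hf' => ?_
  have key := eq_of_eventCode_eq (hcode v hv f f' hf hf') (j := j) (by omega)
    (fun m hm => silentSent_bounds hB hL hv (hj f hf) hm)
    (fun m hm => silentSent_bounds hB hL hv (hj f' hf') hm)
  rw [sent, sent, config_add_eq_silentRun A G _ (hL.eq_center v hv) (hj f hf),
    config_add_eq_silentRun A G _ (hL.eq_center v hv) (hj f' hf')]
  exact key

theorem Synced.add_of_silent (hB : A.Bounded G h k b) (hL : G.LeavesAt c L)
    (hcode : A.SameCode G h hL T b k S t) (hS : A.Synced G h L S t) {f₀ : Fin n → F}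
    (hf₀ : ∀ v, f₀ v ∈ S v) {j : ℕ} (hT : t + j ≤ T)
    (hj : ∀ s, t ≤ s → s < t + j → ¬ A.Active G (fun w => h w (f₀ w)) s c) :
    A.Synced G h L S (t + j) ∧ ∀ f : Fin n → F, (∀ v, f v ∈ S v) →
      ∀ s, t ≤ s → s < t + j → ¬ A.Active G (fun w => h w (f w)) s c := by
  induction j with
  | zero => exact ⟨hS, fun f _ s hs hs' => by omega⟩
  | succ j ih =>
    obtain ⟨h1, h2⟩ := ih (by omega) fun s hs hs' => hj s hs (by omega)
    refine ⟨h1.succ_of_silent hB hL hcode (by omega) h2, fun f hf s hs hs' hact => ?_⟩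
    rcases Nat.lt_or_ge s (t + j) with hlt | hge
    · exact h2 f hf s hs hlt hact
    · obtain rfl : s = t + j := by omega
      refine hj (t + j) hs hs' ?_
      obtain ⟨i, hi⟩ := hact
      refine ⟨i, ?_⟩
      rwa [sent, ← h1 f f₀ hf hf₀ c (Or.inl hL.notMem)]

theorem Synced.next_activation (hB : A.Bounded G h k b) (hL : G.LeavesAt c L)
    (hcode : A.SameCode G h hL T b k S t) (hS : A.Synced G h L S t) (hne : ∀ v, (S v).Nonempty)
    (htT : t ≤ T) :
    ∃ t' ≤ T, t ≤ t' ∧ A.Synced G h L S t' ∧ (t' = T ∨ ∀ f : Fin n → F, (∀ v, f v ∈ S v) →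
      ∃ s, t ≤ s ∧ s < t' ∧ A.Active G (fun w => h w (f w)) s c) := by
  classical
  choose f₀ hf₀ using hne
  by_cases hex : ∃ j, t + j < T ∧ A.Active G (fun w => h w (f₀ w)) (t + j) c
  · have hmin : ∀ s, t ≤ s → s < t + Nat.find hex → ¬ A.Active G (fun w => h w (f₀ w)) s c := by
      intro s hs hs' hact
      have h1 := (Nat.find_spec hex).1
      refine Nat.find_min hex (m := s - t) (by omega) ⟨by omega, ?_⟩
      rwa [Nat.add_sub_cancel' hs]
    obtain ⟨hlt, i, hi⟩ := Nat.find_spec hex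
    obtain ⟨h1, h2⟩ := hS.add_of_silent hB hL hcode hf₀ hlt.le hmin
    refine ⟨t + Nat.find hex + 1, hlt, by omega, h1.succ_of_silent hB hL hcode hlt h2,
      Or.inr fun f hf => ⟨t + Nat.find hex, by omega, by omega, i, ?_⟩⟩
    rwa [sent, h1 f f₀ hf hf₀ c (Or.inl hL.notMem)]
  · obtain ⟨h1, -⟩ := hS.add_of_silent hB hL hcode hf₀ (j := T - t) (by omega)
      fun s hs hs' hact => hex ⟨s - t, by omega, by rwa [Nat.add_sub_cancel' hs]⟩
    rw [Nat.add_sub_cancel' htT] at h1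
    exact ⟨T, le_rfl, htT, h1, Or.inl rfl⟩

end Algorithm

/-- The centre `0` is joined to `1, …, Δ`, and a path `Δ, Δ + 1, …` is attached to the last of these
neighbours. -/
def broomGraph (n Δ : ℕ) : SimpleGraph (Fin n) where
  Adj i j := (i.val = 0 ∧ 1 ≤ j.val ∧ j.val ≤ Δ) ∨ (j.val = 0 ∧ 1 ≤ i.val ∧ i.val ≤ Δ) ∨
    (1 ≤ i.val ∧ Δ ≤ i.val ∧ j.val = i.val + 1) ∨ (1 ≤ j.val ∧ Δ ≤ j.val ∧ i.val = j.val + 1)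
  symm := ⟨fun i j h => by tauto⟩
  loopless := ⟨fun i h => by omega⟩

instance (n Δ : ℕ) : DecidableRel (broomGraph n Δ).Adj := fun i j => by
  unfold broomGraph; infer_instance

theorem broomGraph_adj {n Δ : ℕ} {i j : Fin n} : (broomGraph n Δ).Adj i j ↔
    (i.val = 0 ∧ 1 ≤ j.val ∧ j.val ≤ Δ) ∨ (j.val = 0 ∧ 1 ≤ i.val ∧ i.val ≤ Δ) ∨
    (1 ≤ i.val ∧ Δ ≤ i.val ∧ j.val = i.val + 1) ∨
    (1 ≤ j.val ∧ Δ ≤ j.val ∧ i.val = j.val + 1) := Iff.rfl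

theorem degree_broomGraph_zero {n Δ : ℕ} (hn : Δ < n) :
    (broomGraph n Δ).degree ⟨0, by omega⟩ = Δ := by
  rcases Nat.eq_zero_or_pos Δ with rfl | hΔ
  · rw [SimpleGraph.degree, Finset.card_eq_zero, Finset.eq_empty_iff_forall_notMem]
    intro v hv
    rw [SimpleGraph.mem_neighborFinset, broomGraph_adj] at hv
    simp only at hv
    omega
  have : (broomGraph n Δ).neighborFinset ⟨0, by omega⟩ =
      Finset.Icc ⟨1, by omega⟩ ⟨Δ, hn⟩ := by
    ext v
    rw [SimpleGraph.mem_neighborFinset, broomGraph_adj, Finset.mem_Icc, Fin.le_def, Fin.le_def]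
    simp only [true_and]
    omega
  rw [SimpleGraph.degree, this, Fin.card_Icc]
  simp

theorem degree_broomGraph_le {n Δ : ℕ} {v : Fin n} (hv : v.val ≠ 0) :
    (broomGraph n Δ).degree v ≤ 2 := by
  have : ((broomGraph n Δ).neighborFinset v).map Fin.valEmbedding ⊆
      {if v.val ≤ Δ then 0 else v.val - 1, v.val + 1} := by
    intro w hw
    obtain ⟨u, hu, rfl⟩ := Finset.mem_map.1 hw
    rw [SimpleGraph.mem_neighborFinset, broomGraph_adj] at hu
    simp only [Fin.valEmbedding_apply, Finset.mem_insert, Finset.mem_singleton]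
    split_ifs <;> omega
  rw [SimpleGraph.degree, ← Finset.card_map Fin.valEmbedding]
  exact (Finset.card_le_card this).trans Finset.card_le_two

theorem maxDegree_broomGraph {n Δ : ℕ} (hΔ : 2 ≤ Δ) (hn : Δ < n) :
    (broomGraph n Δ).maxDegree = Δ := by
  apply le_antisymm
  · refine SimpleGraph.maxDegree_le_of_forall_degree_le _ _ fun v => ?_
    by_cases hv : v.val = 0
    · rw [show v = ⟨0, by omega⟩ from Fin.ext hv]
      exact (degree_broomGraph_zero hn).le
    · exact (degree_broomGraph_le hv).trans hΔ
  · exact (degree_broomGraph_zero hn).symm.le.trans (SimpleGraph.degree_le_maxDegree _ _)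

theorem isDFSOrdering_broomGraph (n Δ : ℕ) (hΔ : 1 ≤ Δ) :
    IsDFSOrdering (broomGraph n Δ) (Equiv.refl _) := by
  intro i i' hi
  simp only [Equiv.refl_symm, Equiv.refl_apply, broomGraph_adj]
  have := i'.isLt
  by_cases h : i'.val ≤ Δ
  · refine ⟨⟨0, by omega⟩, by simp [Fin.le_def], by simp only [true_and]; omega, ?_⟩
    intro l hl hl' m hm
    simp only [Fin.lt_def, Fin.le_def] at hl hl' hm
    omega
  · refine ⟨i, le_rfl, by omega, ?_⟩
    intro l hl hli
    exact absurd hl (not_lt.2 hli)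

/-- The broom graph as a network, with identifiers `1, …, n`. -/
noncomputable def broomNetwork (n Δ : ℕ) : Network n where
  graph := broomGraph n Δ
  N := n
  le_N := le_rfl
  id v := v.val + 1
  id_injective v w h := Fin.ext (by simpa using h)
  id_pos v := by omega
  id_le v := by omega
  ports v := (Fintype.equivFinOfCardEq ((broomGraph n Δ).card_neighborSet_eq_degree v)).symm

/-- The leaves at the centre of the broom. -/
def broomLeaves (n Δ : ℕ) : Set (Fin n) := {v | 1 ≤ v.val ∧ v.val < Δ}

theorem leavesAt_broomNetwork {n Δ : ℕ} (hn : 0 < n) :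
    (broomNetwork n Δ).LeavesAt ⟨0, hn⟩ (broomLeaves n Δ) where
  notMem := by simp [broomLeaves]
  adj v hv := by
    simp only [broomLeaves, Set.mem_ofPred_eq] at hv
    refine broomGraph_adj.2 (Or.inr (Or.inl ⟨rfl, by omega, by omega⟩))
  eq_center v hv w hw := by
    simp only [broomLeaves, Set.mem_ofPred_eq] at hv
    have hw := broomGraph_adj.1 hw
    exact Fin.ext (by simp only; omega)

/-- The instance of Depth First Pointer Chasing on the broom. -/
noncomputable def broomInstance {n Δ : ℕ} (hΔ : 1 ≤ Δ) (x : Fin n) (f : Fin n → Fin n → Fin n) :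
    DFPCInstance n where
  toNetwork := broomNetwork n Δ
  dfs := Equiv.refl _
  isDFS := isDFSOrdering_broomGraph n Δ hΔ
  func := f
  start := x

/-- The input of the vertex `v` with function `g` in an instance with `DFS(v) = v`. -/
def chasingInput {n : ℕ} (x : Fin n) (v : Fin n) (g : Fin n → Fin n) : DFPCInput where
  n := n
  index := v
  func := g
  start := if v.val = 0 then some x else none

theorem input_broomInstance {n Δ : ℕ} (hΔ : 1 ≤ Δ) (x : Fin n) (f : Fin n → Fin n → Fin n) :
    (broomInstance hΔ x f).input = fun v => chasingInput x v (f v) := rfl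

theorem broomInstance_mem {n Δ : ℕ} {q : Polynomial ℕ} (hq : n ≤ q.eval n) (hΔ : 2 ≤ Δ)
    (hn : Δ < n) (x : Fin n) (f : Fin n → Fin n → Fin n) :
    broomInstance (Δ := Δ) (by omega) x f ∈ dfpcInstancesOfMaxDegree q n Δ :=
  ⟨hq, maxDegree_broomGraph hΔ hn⟩

/-- The value reached from `x` after the functions of the vertices of index `< j`. -/
def chase {n : ℕ} (x : Fin n) (f : Fin n → Fin n → Fin n) : ℕ → Fin n
  | 0 => x
  | j + 1 => if hj : j < n then f ⟨j, hj⟩ (chase x f j) else chase x f j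

theorem foldl_finRange_take {n : ℕ} (x : Fin n) (f : Fin n → Fin n → Fin n) (j : ℕ) :
    ((List.finRange n).take j).foldl (fun y i => f i y) x = chase x f j := by
  induction j with
  | zero => rfl
  | succ j ih =>
    rw [List.take_add_one, List.foldl_append, ih, chase]
    split_ifs with hj
    · simp [hj]
    · rw [List.getElem?_eq_none (by simpa using hj)]
      rfl

theorem value_broomInstance {n Δ : ℕ} (hΔ : 1 ≤ Δ) (x : Fin n) (f : Fin n → Fin n → Fin n) :
    (broomInstance hΔ x f).value = chase x f n := by
  rw [← foldl_finRange_take, List.take_of_length_le (by simp)]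
  rfl

theorem chase_eq_of_forall_id {n : ℕ} {x : Fin n} {f : Fin n → Fin n → Fin n} {j : ℕ}
    (hf : ∀ v : Fin n, j ≤ v.val → f v = id) {i : ℕ} (hi : j ≤ i) : chase x f i = chase x f j := by
  induction i, hi using Nat.le_induction with
  | base => rfl
  | succ i hi ih =>
    rw [chase]
    split_ifs with h
    · rw [hf ⟨i, h⟩ hi, ih]; rfl
    · exact ih

theorem exists_large_fiber {F γ : Type} [Fintype γ] {S : Finset F} (hS : S.Nonempty) (code : F → γ) :
    ∃ S' ⊆ S, S'.Nonempty ∧ S.card ≤ Fintype.card γ * S'.card ∧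
      ∀ a ∈ S', ∀ a' ∈ S', code a = code a' := by
  classical
  have : Nonempty γ := ⟨code hS.choose⟩
  obtain ⟨y, -, hy⟩ := Finset.exists_max_image Finset.univ
    (fun y => (S.filter fun a => code a = y).card) Finset.univ_nonempty
  have hcard : S.card ≤ Fintype.card γ * (S.filter fun a => code a = y).card := by
    rw [Finset.card_eq_sum_card_fiberwise (f := code) (t := Finset.univ) fun _ _ => by simp]
    exact Finset.sum_le_card_nsmul _ _ _ hy
  refine ⟨_, Finset.filter_subset _ _, ?_, hcard, ?_⟩
  · rw [← Finset.card_pos]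
    exact Nat.pos_of_mul_pos_left (hS.card_pos.trans_le hcard)
  · intro a ha a' ha'
    exact (Finset.mem_filter.1 ha).2.trans (Finset.mem_filter.1 ha').2.symm

/-- A dense set of functions takes many values at some point of every large set. -/
theorem exists_many_values {n M : ℕ} {S : Finset (Fin n → Fin n)} (hS : n ^ n ≤ M * S.card)
    (hM : M ≤ 2 ^ (n / 2)) {Z : Finset (Fin n)} (hZ : n < 2 * Z.card) :
    ∃ z ∈ Z, n < 2 * (S.image fun g => g z).card := by
  by_contra! hcon
  have hn : 0 < n ^ n := Nat.pow_self_pos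
  have hSpos : 0 < S.card := Nat.pos_of_mul_pos_left (hn.trans_le hS)
  have h1 : S.card ≤ ∏ z, (S.image fun g => g z).card := by
    rw [← Fintype.card_piFinset]
    refine Finset.card_le_card fun g hg => ?_
    rw [Fintype.mem_piFinset]
    exact fun z => Finset.mem_image_of_mem (fun g : Fin n → Fin n => g z) hg
  have h2 : 2 ^ Z.card * S.card ≤ n ^ n := by
    calc 2 ^ Z.card * S.card
        ≤ (∏ z, if z ∈ Z then 2 else 1) * ∏ z, (S.image fun g => g z).card := by
          refine Nat.mul_le_mul (le_of_eq ?_) h1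
          simp [Finset.prod_ite_mem]
      _ = ∏ z, (if z ∈ Z then 2 else 1) * (S.image fun g => g z).card :=
          Finset.prod_mul_distrib.symm
      _ ≤ ∏ _z : Fin n, n := by
          refine Finset.prod_le_prod' fun z _ => ?_
          split_ifs with hz
          · exact hcon z hz
          · rw [one_mul]
            exact (Finset.card_le_univ _).trans (by simp)
      _ = n ^ n := by simp
  have h3 : 2 ^ Z.card ≤ 2 ^ (n / 2) :=
    (Nat.le_of_mul_le_mul_right (h2.trans hS) hSpos).trans hM
  have := (Nat.pow_le_pow_iff_right (by norm_num)).1 h3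
  omega

namespace Algorithm

variable {α β F : Type} {n : ℕ} {A : Algorithm α β} {G : Network n} {h : Fin n → F → α}
  {L : Set (Fin n)} {S : Fin n → Finset F} {c : Fin n} {t : ℕ}

theorem config_add_eq_of_isSome {x : Fin n → α} {v : Fin n}
    (hv : (A.output (A.config G x t v)).isSome) (j : ℕ) :
    A.config G x (t + j) v = A.config G x t v := by
  induction j with
  | zero => rfl
  | succ j ih => rw [← add_assoc, config_succ, ih, if_pos hv]

theorem output_eq_of_isSome {x : Fin n → α} {v : Fin n} {t' : ℕ}
    (hv : (A.output (A.config G x t v)).isSome) (hv' : (A.output (A.config G x t' v)).isSome) :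
    A.output (A.config G x t v) = A.output (A.config G x t' v) := by
  rcases le_total t t' with hle | hle
  · obtain ⟨j, rfl⟩ := Nat.exists_eq_add_of_le hle
    exact congrArg A.output (config_add_eq_of_isSome hv j).symm
  · obtain ⟨j, rfl⟩ := Nat.exists_eq_add_of_le hle
    exact congrArg A.output (config_add_eq_of_isSome hv' j)

/-- A synced box contains a large box on which the behaviour of the leaves under silence of the
centre is constant. -/
theorem Synced.exists_sameCode (hS : A.Synced G h L S t) (hL : G.LeavesAt c L)
    (hne : ∀ v, (S v).Nonempty) (T b k : ℕ) :
    ∃ S' : Fin n → Finset F, (∀ v, S' v ⊆ S v) ∧ (∀ v, (S' v).Nonempty) ∧ (∀ v ∉ L, S' v = S v) ∧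
      (∀ v ∈ L, (S v).card ≤ (T * 3 ^ b + 1) ^ k * (S' v).card) ∧
      ∀ v (hv : v ∈ L), ∀ f f' : Fin n → F, (∀ v, f v ∈ S v) → (∀ v, f' v ∈ S v) →
        f v ∈ S' v → f' v ∈ S' v →
        eventCode T b k (A.silentSent G (hL.adj v hv) (A.config G (fun w => h w (f w)) t v)) =
        eventCode T b k (A.silentSent G (hL.adj v hv) (A.config G (fun w => h w (f' w)) t v)) := by
  classical
  choose f₀ hf₀ using hne
  have key : ∀ v, ∃ S' ⊆ S v, S'.Nonempty ∧ (v ∉ L → S' = S v) ∧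
      (v ∈ L → (S v).card ≤ (T * 3 ^ b + 1) ^ k * S'.card) ∧
      ∀ hv : v ∈ L, ∀ f f' : Fin n → F, (∀ v, f v ∈ S v) → (∀ v, f' v ∈ S v) →
        f v ∈ S' → f' v ∈ S' →
        eventCode T b k (A.silentSent G (hL.adj v hv) (A.config G (fun w => h w (f w)) t v)) =
        eventCode T b k
          (A.silentSent G (hL.adj v hv) (A.config G (fun w => h w (f' w)) t v)) := by
    intro v
    by_cases hv : v ∈ L
    · obtain ⟨S', h1, h2, h3, h4⟩ := exists_large_fiber ⟨f₀ v, hf₀ v⟩ fun g : F =>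
        eventCode T b k (A.silentSent G (hL.adj v hv)
          (A.config G (fun w => h w (Function.update f₀ v g w)) t v))
      refine ⟨S', h1, h2, fun hv' => absurd hv hv', fun _ => by simpa using h3, ?_⟩
      intro _ f f' hf hf' hfS hfS'
      have hup : ∀ f : Fin n → F, (∀ v, f v ∈ S v) →
          A.config G (fun w => h w (f w)) t v =
          A.config G (fun w => h w (Function.update f₀ v (f v) w)) t v := by
        intro f hf
        refine hS f _ hf (fun w => ?_) v (Or.inr (by simp))
        rcases eq_or_ne w v with rfl | hwv
        · simpa using hf w
        · simpa [hwv] using hf₀ w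
      rw [hup f hf, hup f' hf']
      exact h4 _ hfS _ hfS'
    · exact ⟨S v, subset_rfl, ⟨_, hf₀ v⟩, fun _ => rfl, fun hv' => absurd hv' hv,
        fun hv' => absurd hv' hv⟩
  choose S' h1 h2 h3 h4 h5 using key
  exact ⟨S', h1, h2, h3, h4, h5⟩

end Algorithm

/-- The state of the adversary after `r` activations of the centre of the broom: a box `S` of
functions on which the executions up to time `t` look the same outside the leaves, on which
the chase has reached the leaf `r + 1` with the value `z`, and on which this leaf still has many
possible values at `z`. -/
structure AdversaryState {n : ℕ} (A : Algorithm DFPCInput ℕ) (Δ : ℕ) (hn : 0 < n) (x : Fin n)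
    (T b k r t : ℕ) (S : Fin n → Finset (Fin n → Fin n)) (z : Fin n) : Prop where
  nonempty : ∀ v, (S v).Nonempty
  le : t ≤ T
  synced : A.Synced (broomNetwork n Δ) (chasingInput x) (broomLeaves n Δ) S t
  sameCode : A.SameCode (broomNetwork n Δ) (chasingInput x) (leavesAt_broomNetwork hn) T b k S t
  activity : t = T ∨ ∀ f : Fin n → Fin n → Fin n, (∀ v, f v ∈ S v) →
    (r : ℕ∞) ≤ {s | s < t ∧
      A.Active (broomNetwork n Δ) (fun w => chasingInput x w (f w)) s ⟨0, hn⟩}.encard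
  chase_eq : ∀ f : Fin n → Fin n → Fin n, (∀ v, f v ∈ S v) → chase x f (r + 1) = z
  many : ∀ v : Fin n, v.val = r + 1 → n < 2 * ((S v).image fun g => g z).card
  large : ∀ v : Fin n, r + 1 < v.val → v.val < Δ →
    n ^ n ≤ ((T * 3 ^ b + 1) ^ k) ^ (r + 1) * (S v).card
  rest : ∀ v ∉ broomLeaves n Δ, S v = {id}

section Adversary

variable {n Δ T b k : ℕ} {A : Algorithm DFPCInput ℕ}

theorem exists_adversaryState_zero (hΔ : 2 ≤ Δ) (hn : Δ < n)
    (hM : (T * 3 ^ b + 1) ^ k ≤ 2 ^ (n / 2)) :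
    ∃ x S, AdversaryState A Δ (by omega : 0 < n) x T b k 0 0 S x := by
  classical
  have hn0 : 0 < n := by omega
  have hL := leavesAt_broomNetwork (Δ := Δ) hn0
  let S₀ : Fin n → Finset (Fin n → Fin n) := fun v =>
    if v ∈ broomLeaves n Δ then Finset.univ else {id}
  have hne : ∀ v, (S₀ v).Nonempty := by
    intro v
    have : Nonempty (Fin n) := ⟨⟨0, hn0⟩⟩
    simp only [S₀]
    split_ifs
    · exact Finset.univ_nonempty
    · exact Finset.singleton_nonempty _
  have hsync : ∀ x, A.Synced (broomNetwork n Δ) (chasingInput x) (broomLeaves n Δ) S₀ 0 := by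
    intro x f f' hf hf' v hv
    have : f v = f' v := by
      rcases hv with hv | hv
      · have h1 := hf v
        have h2 := hf' v
        simp only [S₀, if_neg hv, Finset.mem_singleton] at h1 h2
        rw [h1, h2]
      · exact hv
    simp only [Algorithm.config, this]
  obtain ⟨S, h1, h2, h3, h4, h5⟩ := (hsync ⟨0, hn0⟩).exists_sameCode hL hne T b k
  have hlarge : ∀ v ∈ broomLeaves n Δ, n ^ n ≤ (T * 3 ^ b + 1) ^ k * (S v).card := by
    intro v hv
    have := h4 v hv
    simpa only [S₀, if_pos hv, Finset.card_univ, Fintype.card_fun, Fintype.card_fin] using this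
  have hmem : (⟨1, by omega⟩ : Fin n) ∈ broomLeaves n Δ := ⟨le_rfl, by simp only; omega⟩
  obtain ⟨x, -, hx⟩ := exists_many_values (hlarge _ hmem) hM (Z := Finset.univ)
    (by simp only [Finset.card_univ, Fintype.card_fin]; omega)
  refine ⟨x, S, h2, Nat.zero_le _, (hsync x).mono h1, ?_, Or.inr fun f _ => by simp, ?_, ?_, ?_, ?_⟩
  · intro v hv f f' hf hf'
    have hcfg : ∀ f : Fin n → Fin n → Fin n,
        A.config (broomNetwork n Δ) (fun w => chasingInput x w (f w)) 0 v =
        A.config (broomNetwork n Δ) (fun w => chasingInput ⟨0, hn0⟩ w (f w)) 0 v := by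
      intro f
      have hv0 : v.val ≠ 0 := by have := hv.1; omega
      simp only [Algorithm.config, chasingInput, if_neg hv0]
    rw [hcfg f, hcfg f']
    exact h5 v hv f f' (fun v => h1 v (hf v)) (fun v => h1 v (hf' v)) (hf v) (hf' v)
  · intro f hf
    have h0 : f ⟨0, hn0⟩ = id := by
      have := hf ⟨0, hn0⟩
      rw [h3 _ hL.notMem] at this
      simpa only [S₀, if_neg hL.notMem, Finset.mem_singleton] using this
    simp [chase, hn0, h0]
  · intro v hv
    rwa [show (⟨1, by omega⟩ : Fin n) = v from Fin.ext hv.symm] at hx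
  · intro v hv hv'
    simpa using hlarge v ⟨by omega, hv'⟩
  · intro v hv
    rw [h3 v hv]
    exact if_neg hv

theorem AdversaryState.exists_succ {hn0 : 0 < n} {x z : Fin n} {r t : ℕ}
    {S : Fin n → Finset (Fin n → Fin n)} (hS : AdversaryState A Δ hn0 x T b k r t S z)
    (hr : r + 2 < Δ) (hn : Δ < n) (hM : ((T * 3 ^ b + 1) ^ k) ^ (r + 2) ≤ 2 ^ (n / 2))
    (hB : A.Bounded (broomNetwork n Δ) (chasingInput x) k b) :
    ∃ t' S' z', AdversaryState A Δ hn0 x T b k (r + 1) t' S' z' := by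
  classical
  have hL := leavesAt_broomNetwork (Δ := Δ) hn0
  obtain ⟨t', ht'T, htt', hsync, hact⟩ :=
    hS.synced.next_activation hB hL hS.sameCode hS.nonempty hS.le
  obtain ⟨S', h1, h2, h3, h4, h5⟩ := hsync.exists_sameCode hL hS.nonempty T b k
  obtain ⟨u, hu⟩ : ∃ u : Fin n, u.val = r + 1 := ⟨⟨r + 1, by omega⟩, rfl⟩
  have hlarge : ∀ v : Fin n, r + 1 < v.val → v.val < Δ →
      n ^ n ≤ ((T * 3 ^ b + 1) ^ k) ^ (r + 2) * (S' v).card := by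
    intro v hv hv'
    calc n ^ n ≤ ((T * 3 ^ b + 1) ^ k) ^ (r + 1) * (S v).card := hS.large v hv hv'
      _ ≤ ((T * 3 ^ b + 1) ^ k) ^ (r + 1) * ((T * 3 ^ b + 1) ^ k * (S' v).card) :=
        Nat.mul_le_mul_left _ (h4 v ⟨by omega, hv'⟩)
      _ = _ := by ring
  obtain ⟨z', hz', hmany⟩ := exists_many_values
    (hlarge ⟨r + 2, by omega⟩ (by simp) hr) hM (hS.many u hu)
  obtain ⟨g, hg, hgz⟩ := Finset.mem_image.1 hz'
  have hsub : ∀ v, Function.update S' u {g} v ⊆ S v := by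
    intro v
    rcases eq_or_ne v u with rfl | hvu
    · simpa using hg
    · simpa [hvu] using h1 v
  have huL : u ∈ broomLeaves n Δ := ⟨by omega, by omega⟩
  refine ⟨t', Function.update S' u {g}, z', ?_, ht'T, hsync.mono hsub, ?_, ?_, ?_, ?_, ?_, ?_⟩
  · intro v
    rcases eq_or_ne v u with rfl | hvu
    · simp
    · simpa [hvu] using h2 v
  · intro v hv f f' hf hf'
    have hfv := hf v
    have hfv' := hf' v
    rcases eq_or_ne v u with rfl | hvu
    · simp only [Function.update_self, Finset.mem_singleton] at hfv hfv'
      rw [hsync f f' (fun w => hsub w (hf w)) (fun w => hsub w (hf' w)) v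
        (Or.inr (hfv.trans hfv'.symm))]
    · rw [Function.update_of_ne hvu] at hfv hfv'
      exact h5 v hv f f' (fun w => hsub w (hf w)) (fun w => hsub w (hf' w)) hfv hfv'
  · rcases hact with hact | hact
    · exact Or.inl hact
    rcases hS.activity with rfl | hr'
    · exact Or.inl (le_antisymm ht'T htt')
    right
    intro f hf
    have hfS : ∀ v, f v ∈ S v := fun v => hsub v (hf v)
    obtain ⟨s, hs, hs', hsact⟩ := hact f hfS
    refine le_trans ?_ (Set.encard_le_encard (s := insert s {s | s < t ∧
      A.Active (broomNetwork n Δ) (fun w => chasingInput x w (f w)) s ⟨0, hn0⟩}) ?_)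
    · rw [Set.encard_insert_of_notMem fun hmem => absurd hmem.1 (by omega)]
      push_cast
      exact add_le_add_left (hr' f hfS) 1
    · rintro i (rfl | hi)
      · exact ⟨hs', hsact⟩
      · exact ⟨by have := hi.1; omega, hi.2⟩
  · intro f hf
    have hfu := hf u
    simp only [Function.update_self, Finset.mem_singleton] at hfu
    have hlt : r + 1 < n := by omega
    have hu' : (⟨r + 1, hlt⟩ : Fin n) = u := Fin.ext hu.symm
    rw [chase, dif_pos hlt, hS.chase_eq f fun v => hsub v (hf v), hu', hfu, hgz]
  · intro v hv
    have hvu : v ≠ u := fun h => by rw [h] at hv; omega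
    rw [Function.update_of_ne hvu]
    rwa [show (⟨r + 2, by omega⟩ : Fin n) = v from Fin.ext hv.symm] at hmany
  · intro v hv hv'
    have hvu : v ≠ u := fun h => by rw [h] at hv; omega
    rw [Function.update_of_ne hvu]
    exact hlarge v (by omega) hv'
  · intro v hv
    have hvu : v ≠ u := fun h => hv (h ▸ huL)
    rw [Function.update_of_ne hvu, h3 v hv, hS.rest v hv]

theorem AdversaryState.synced_end {hn0 : 0 < n} {x z : Fin n} {t : ℕ}
    {S : Fin n → Finset (Fin n → Fin n)} (hS : AdversaryState A Δ hn0 x T b k k t S z)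
    (hB : A.Bounded (broomNetwork n Δ) (chasingInput x) k b) :
    A.Synced (broomNetwork n Δ) (chasingInput x) (broomLeaves n Δ) S T := by
  obtain ⟨t', ht'T, htt', hsync, hact⟩ := hS.synced.next_activation hB
    (leavesAt_broomNetwork hn0) hS.sameCode hS.nonempty hS.le
  rcases hact with rfl | hact
  · exact hsync
  rcases hS.activity with rfl | hr'
  · exact hS.synced
  exfalso
  choose f hf using hS.nonempty
  obtain ⟨s, hs, -, hsact⟩ := hact f hf
  have hle : ((k + 1 : ℕ) : ℕ∞) ≤ k := by
    refine le_trans ?_ ((Set.encard_le_encard (s := insert s {s | s < t ∧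
      A.Active (broomNetwork n Δ) (fun w => chasingInput x w (f w)) s ⟨0, hn0⟩}) ?_).trans
      (hB.activity f ⟨0, hn0⟩))
    · rw [Set.encard_insert_of_notMem fun hmem => absurd hmem.1 (by omega)]
      push_cast
      exact add_le_add_left (hr' f hf) 1
    · rintro i (rfl | hi)
      · exact hsact
      · exact hi.2
  have : k + 1 ≤ k := by exact_mod_cast hle
  omega

/-- No algorithm whose nodes are active in at most `Δ - 2` rounds solves all instances on the broom,
provided that the total information that a leaf can send is small compared to `n`. -/
theorem not_solves_broomInstance (hΔ : 2 ≤ Δ) (hn : Δ < n)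
    (hM : ((T * 3 ^ b + 1) ^ (Δ - 2)) ^ (Δ - 1) ≤ 2 ^ (n / 2))
    (hhalt : ∀ (x : Fin n) (f : Fin n → Fin n → Fin n),
      A.HaltsBy (broomNetwork n Δ) (fun v => chasingInput x v (f v)) T)
    (hB : ∀ x, A.Bounded (broomNetwork n Δ) (chasingInput x) (Δ - 2) b)
    (hsolve : ∀ x f, SolvesDFPC A (broomInstance (n := n) (by omega : 1 ≤ Δ) x f)) : False := by
  classical
  have hn0 : 0 < n := by omega
  have hM' : ∀ r, r + 2 ≤ Δ → ((T * 3 ^ b + 1) ^ (Δ - 2)) ^ (r + 1) ≤ 2 ^ (n / 2) := fun r hr =>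
    (Nat.pow_le_pow_right (by positivity) (by omega)).trans hM
  obtain ⟨x, S₀, hS₀⟩ := exists_adversaryState_zero (A := A) hΔ hn
    (by simpa using hM' 0 hΔ)
  have hphase : ∀ r, r + 2 ≤ Δ → ∃ t S z, AdversaryState A Δ hn0 x T b (Δ - 2) r t S z := by
    intro r
    induction r with
    | zero => exact fun _ => ⟨0, S₀, x, hS₀⟩
    | succ r ih =>
      intro hr
      obtain ⟨t, S, z, hS⟩ := ih (by omega)
      exact hS.exists_succ (by omega) hn (hM' (r + 1) hr) (hB x)
  obtain ⟨t, S, z, hS⟩ := hphase (Δ - 2) (by omega)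
  have hsync := hS.synced_end (hB x)
  have hroot : ∀ f, A.output (A.config (broomNetwork n Δ) (fun v => chasingInput x v (f v)) T
      ⟨0, hn0⟩) = some (chase x f n).val := by
    intro f
    obtain ⟨T', h1, h2⟩ := hsolve x f
    rw [← value_broomInstance (by omega : 1 ≤ Δ), ← h2 ⟨0, hn0⟩ rfl]
    exact Algorithm.output_eq_of_isSome (hhalt x f _) (h1 _)
  obtain ⟨u, hu⟩ : ∃ u : Fin n, u.val = Δ - 2 + 1 := ⟨⟨Δ - 2 + 1, by omega⟩, rfl⟩
  have hchase : ∀ f : Fin n → Fin n → Fin n, (∀ v, f v ∈ S v) → chase x f n = f u z := by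
    intro f hf
    have hlt : Δ - 2 + 1 < n := by omega
    have hu' : (⟨Δ - 2 + 1, hlt⟩ : Fin n) = u := Fin.ext hu.symm
    rw [chase_eq_of_forall_id (j := Δ - 2 + 1 + 1) (fun v hv => ?_) (by omega), chase,
      dif_pos hlt, hS.chase_eq f hf, hu']
    have := hf v
    rw [hS.rest v fun h => by have := h.2; omega] at this
    simpa using this
  have hcard : 1 < ((S u).image fun g => g z).card := by have := hS.many u hu; omega
  obtain ⟨y₁, hy₁, y₂, hy₂, hne⟩ := Finset.one_lt_card.1 hcard
  obtain ⟨g₁, hg₁, rfl⟩ := Finset.mem_image.1 hy₁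
  obtain ⟨g₂, hg₂, rfl⟩ := Finset.mem_image.1 hy₂
  choose f₀ hf₀ using hS.nonempty
  have hup : ∀ g ∈ S u, ∀ v, Function.update f₀ u g v ∈ S v := by
    intro g hg v
    rcases eq_or_ne v u with rfl | hvu
    · simpa using hg
    · simpa [hvu] using hf₀ v
  have heq := congrArg A.output (hsync _ _ (hup g₁ hg₁) (hup g₂ hg₂) ⟨0, hn0⟩
    (Or.inl (leavesAt_broomNetwork hn0).notMem))
  rw [hroot, hroot, hchase _ (hup g₁ hg₁), hchase _ (hup g₂ hg₂)] at heq
  simp only [Function.update_self, Option.some.injEq] at heq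
  exact hne (Fin.ext heq)

end Adversary

open Filter in
theorem eventually_log_le {ε : ℝ} (hε : 0 < ε) : ∀ᶠ n : ℕ in atTop, Real.log n ≤ ε * n := by
  filter_upwards [tendsto_natCast_atTop_atTop.eventually
    (Real.isLittleO_log_id_atTop.bound hε)] with n hn
  simpa using (le_abs_self _).trans hn

theorem eval_le_pow (p : Polynomial ℕ) {n : ℕ} (h1 : 1 ≤ n) (hn : p.eval 1 ≤ n) :
    p.eval n ≤ n ^ (p.natDegree + 1) := by
  calc p.eval n = ∑ i ∈ Finset.range (p.natDegree + 1), p.coeff i * n ^ i :=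
        Polynomial.eval_eq_sum_range n
    _ ≤ ∑ i ∈ Finset.range (p.natDegree + 1), p.coeff i * n ^ p.natDegree :=
        Finset.sum_le_sum fun i hi => Nat.mul_le_mul_left _
          (Nat.pow_le_pow_right h1 (Nat.lt_succ_iff.1 (Finset.mem_range.1 hi)))
    _ = p.eval 1 * n ^ p.natDegree := by
        rw [Polynomial.eval_eq_sum_range, Finset.sum_mul]
        simp
    _ ≤ n * n ^ p.natDegree := Nat.mul_le_mul_right _ hn
    _ = n ^ (p.natDegree + 1) := by ring

theorem three_pow_floor_le (B : ℝ) {n : ℕ} (hn : 1 ≤ n) :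
    3 ^ ⌊B * Real.log n⌋₊ ≤ n ^ (2 * ⌈|B|⌉₊) := by
  have hn' : (1 : ℝ) ≤ n := by exact_mod_cast hn
  have hlog : 0 ≤ Real.log n := Real.log_nonneg hn'
  have hB : B * Real.log n ≤ ⌈|B|⌉₊ * Real.log n :=
    mul_le_mul_of_nonneg_right ((le_abs_self B).trans (Nat.le_ceil _)) hlog
  have hfl : (⌊B * Real.log n⌋₊ : ℝ) ≤ ⌈|B|⌉₊ * Real.log n := by
    rcases le_total 0 (B * Real.log n) with h | h
    · exact (Nat.floor_le h).trans hB
    · rw [Nat.floor_of_nonpos h, Nat.cast_zero]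
      positivity
  have : (3 : ℝ) ^ ⌊B * Real.log n⌋₊ ≤ (n : ℝ) ^ (2 * ⌈|B|⌉₊) := by
    calc (3 : ℝ) ^ ⌊B * Real.log n⌋₊ ≤ Real.exp 2 ^ ⌊B * Real.log n⌋₊ := by
          refine pow_le_pow_left₀ (by norm_num) ?_ _
          have := Real.add_one_le_exp 2
          linarith
      _ = Real.exp (⌊B * Real.log n⌋₊ * 2) := (Real.exp_nat_mul _ _).symm
      _ ≤ Real.exp ((2 * ⌈|B|⌉₊ : ℕ) * Real.log n) := by
          refine Real.exp_le_exp.2 ?_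
          push_cast
          linarith
      _ = (n : ℝ) ^ (2 * ⌈|B|⌉₊) := by
          rw [Real.exp_nat_mul, Real.exp_log (by linarith)]
  exact_mod_cast this

open Filter in
theorem exists_eventually_le_pow (B : ℝ) (p : Polynomial ℕ) :
    ∃ a : ℕ, ∀ᶠ n : ℕ in atTop, p.eval n * 3 ^ ⌊B * Real.log n⌋₊ + 1 ≤ n ^ a := by
  refine ⟨p.natDegree + 1 + 2 * ⌈|B|⌉₊ + 1, ?_⟩
  filter_upwards [eventually_ge_atTop 2, eventually_ge_atTop (p.eval 1)] with n hn hp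
  have h1 := Nat.mul_le_mul (eval_le_pow p (by omega) hp) (three_pow_floor_le B (n := n) (by omega))
  rw [← pow_add] at h1
  have h2 : 1 ≤ n ^ (p.natDegree + 1 + 2 * ⌈|B|⌉₊) := Nat.one_le_pow _ _ (by omega)
  rw [pow_succ]
  nlinarith

theorem pow_four_mul_log_le {C : ℝ} {n Δ : ℕ} (hn : 2 ≤ n)
    (hΔ : (Δ : ℝ) ≤ C * ((n : ℝ) / Real.log n) ^ (1 / 4 : ℝ)) :
    (Δ : ℝ) ^ 4 * Real.log n ≤ C ^ 4 * n := by
  have hlog : 0 < Real.log n := Real.log_pos (by exact_mod_cast hn)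
  have h1 := pow_le_pow_left₀ (Nat.cast_nonneg Δ) hΔ 4
  rw [mul_pow, ← Real.rpow_natCast (_ ^ (1 / 4 : ℝ)), ← Real.rpow_mul (by positivity)] at h1
  norm_num at h1
  calc (Δ : ℝ) ^ 4 * Real.log n ≤ C ^ 4 * (n / Real.log n) * Real.log n :=
        mul_le_mul_of_nonneg_right h1 hlog.le
    _ = C ^ 4 * n := by field_simp

open Filter in
/-- For `Δ = O((n / log n) ^ (1 / 4))`, the information that a leaf can send is small compared
to `n`. -/
theorem eventually_information_le (C B : ℝ) (p : Polynomial ℕ) :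
    ∀ᶠ n : ℕ in atTop, ∀ Δ : ℕ, (Δ : ℝ) ≤ C * ((n : ℝ) / Real.log n) ^ (1 / 4 : ℝ) →
      Δ < n ∧ ((p.eval n * 3 ^ ⌊B * Real.log n⌋₊ + 1) ^ (Δ - 2)) ^ (Δ - 1) ≤ 2 ^ (n / 2) := by
  obtain ⟨a, ha⟩ := exists_eventually_le_pow B p
  have hε : 0 < 1 / (64 * ((a : ℝ) ^ 2 * C ^ 4 + 1)) := by positivity
  filter_upwards [ha, eventually_log_le hε, eventually_ge_atTop 3,
    eventually_gt_atTop ⌈C ^ 4⌉₊] with n hK hlog hn3 hnC Δ hΔ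
  have h4 := pow_four_mul_log_le (by omega) hΔ
  have hn : (3 : ℝ) ≤ n := by exact_mod_cast hn3
  have hlog1 : 1 ≤ Real.log n := by
    rw [Real.le_log_iff_exp_le (by linarith)]
    linarith [Real.exp_one_lt_three]
  have hC : C ^ 4 < n := (Nat.le_ceil _).trans_lt (by exact_mod_cast hnC)
  constructor
  · by_contra! hle
    have hle' : (n : ℝ) ≤ Δ := by exact_mod_cast hle
    have h5 : (n : ℝ) ^ 4 ≤ C ^ 4 * n :=
      calc (n : ℝ) ^ 4 ≤ (Δ : ℝ) ^ 4 := pow_le_pow_left₀ (by linarith) hle' 4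
        _ ≤ (Δ : ℝ) ^ 4 * Real.log n := le_mul_of_one_le_right (by positivity) hlog1
        _ ≤ _ := h4
    have h6 : C ^ 4 * n < n * n := mul_lt_mul_of_pos_right hC (by linarith)
    have h7 : (n : ℝ) ^ 2 ≤ (n : ℝ) ^ 4 := pow_le_pow_right₀ (by linarith) (by norm_num)
    nlinarith
  have hkey : a * (Δ : ℝ) ^ 2 * Real.log n ≤ n / 8 := by
    rw [← pow_le_pow_iff_left₀ (by positivity) (by positivity) two_ne_zero]
    calc (a * (Δ : ℝ) ^ 2 * Real.log n) ^ 2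
        = a ^ 2 * ((Δ : ℝ) ^ 4 * Real.log n) * Real.log n := by ring
      _ ≤ a ^ 2 * (C ^ 4 * n) * (1 / (64 * ((a : ℝ) ^ 2 * C ^ 4 + 1)) * n) := by gcongr
      _ = (a ^ 2 * C ^ 4) / (a ^ 2 * C ^ 4 + 1) * (n / 8) ^ 2 := by field_simp; norm_num
      _ ≤ 1 * (n / 8) ^ 2 := by
          refine mul_le_mul_of_nonneg_right ?_ (by positivity)
          rw [div_le_one (by positivity)]
          linarith
      _ = (n / 8 : ℝ) ^ 2 := one_mul _
  have hexp : (Δ - 2) * (Δ - 1) ≤ Δ ^ 2 := by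
    rw [sq]
    exact Nat.mul_le_mul (Nat.sub_le _ _) (Nat.sub_le _ _)
  have hfloor : (n : ℝ) / 4 ≤ (n / 2 : ℕ) := by
    have : n ≤ 4 * (n / 2) := by omega
    have : (n : ℝ) ≤ 4 * (n / 2 : ℕ) := by exact_mod_cast this
    linarith
  calc ((p.eval n * 3 ^ ⌊B * Real.log n⌋₊ + 1) ^ (Δ - 2)) ^ (Δ - 1)
      ≤ ((n ^ a) ^ (Δ - 2)) ^ (Δ - 1) := by gcongr
    _ = (n ^ a) ^ ((Δ - 2) * (Δ - 1)) := (pow_mul _ _ _).symm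
    _ ≤ (n ^ a) ^ (Δ ^ 2) := Nat.pow_le_pow_right (Nat.pow_pos (by omega)) hexp
    _ = n ^ (a * Δ ^ 2) := (pow_mul _ _ _).symm
    _ ≤ 2 ^ (n / 2) := by
      have : (n : ℝ) ^ (a * Δ ^ 2) ≤ 2 ^ (n / 2) := by
        rw [← Real.log_le_log_iff (by positivity) (by positivity), Real.log_pow, Real.log_pow]
        push_cast
        have h2 : (1 / 2 : ℝ) ≤ Real.log 2 := by linarith [Real.log_two_gt_d9]
        have h3 : (n : ℝ) / 4 * (1 / 2) ≤ (n / 2 : ℕ) * Real.log 2 := by gcongr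
        linarith
      exact_mod_cast this

theorem le_sub_two_of_lt_half_mul {e : ℕ∞} {Δ : ℕ} (hΔ : 2 ≤ Δ)
    (he : (e : ENNReal) < ENNReal.ofReal (1 / 2 * Δ)) : e ≤ (Δ - 2 : ℕ) := by
  have hne : e ≠ ⊤ := by
    rintro rfl
    simp at he
  lift e to ℕ using hne
  rw [ENat.toENNReal_coe, ← ENNReal.ofReal_natCast,
    ENNReal.ofReal_lt_ofReal_iff (by positivity)] at he
  have : 2 * e < Δ := by
    have : (2 * e : ℝ) < Δ := by linarith
    exact_mod_cast this
  exact_mod_cast (by omega : e ≤ Δ - 2)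

theorem half_mul_le_nodeActivationComplexity {n Δ T : ℕ} {B : ℝ} {q : Polynomial ℕ}
    (hq : n ≤ q.eval n) (hΔ : 2 ≤ Δ) (hn : Δ < n)
    (hM : ((T * 3 ^ ⌊B⌋₊ + 1) ^ (Δ - 2)) ^ (Δ - 1) ≤ 2 ^ (n / 2)) (A : Algorithm DFPCInput ℕ)
    (hA : SolvesDFPCWithin A (dfpcInstancesOfMaxDegree q n Δ) T B) :
    ENNReal.ofReal (1 / 2 * Δ) ≤
      (nodeActivationComplexity A (dfpcInstancesOfMaxDegree q n Δ) : ENNReal) := by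
  by_contra! hlt
  have hle := le_sub_two_of_lt_half_mul hΔ hlt
  have hmem := broomInstance_mem hq hΔ hn
  refine not_solves_broomInstance hΔ hn hM (fun x f => hA.rounds _ (hmem x f)) (fun x => ?_)
    (fun x f => hA.correct _ (hmem x f))
  refine ⟨fun f v => ?_, fun f t v i m hm => ?_⟩
  · refine le_trans ?_ hle
    exact (le_iSup (fun v => {t : ℕ | A.Active (broomNetwork n Δ) _ t v}.encard) v).trans
      (le_iSup₂_of_le (broomInstance (by omega) x f) (hmem x f) le_rfl)
  · exact Nat.le_floor (hA.messages _ (hmem x f) t v i m hm)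

open Filter in
theorem tendsto_div_log_rpow :
    Tendsto (fun n : ℕ => ((n : ℝ) / Real.log n) ^ (1 / 4 : ℝ)) atTop atTop := by
  refine (tendsto_rpow_atTop (by norm_num)).comp ?_
  refine tendsto_atTop.2 fun M => ?_
  filter_upwards [eventually_log_le (ε := 1 / (|M| + 1)) (by positivity), eventually_ge_atTop 2]
    with n hn hn2
  have hlog : 0 < Real.log n := Real.log_pos (by exact_mod_cast hn2)
  rw [le_div_iff₀ hlog]
  calc M * Real.log n ≤ (|M| + 1) * Real.log n :=
        mul_le_mul_of_nonneg_right (by linarith [le_abs_self M]) hlog.le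
    _ ≤ (|M| + 1) * (1 / (|M| + 1) * n) := by gcongr
    _ = n := by field_simp

/-- `C`, `B`, `p`, `q` are the constant in the bound on `Δ`, the constant in the message size
`O(log n)`, the polynomial bounding the number of rounds, and the polynomial bounding identifiers. -/
theorem mainTheorem3 (C B : ℝ) (p q : Polynomial ℕ) (hq : ∀ n : ℕ, n ≤ q.eval n) :
    (∃ c : ℝ, 0 < c ∧ ∃ n₀ : ℕ, ∀ n ≥ n₀, ∀ Δ : ℕ, 2 ≤ Δ →
      (Δ : ℝ) ≤ C * ((n : ℝ) / Real.log n) ^ (1 / 4 : ℝ) →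
      ∀ A : Algorithm DFPCInput ℕ,
        SolvesDFPCWithin A (dfpcInstancesOfMaxDegree q n Δ) (p.eval n) (B * Real.log n) →
        ENNReal.ofReal (c * Δ) ≤
          (nodeActivationComplexity A (dfpcInstancesOfMaxDegree q n Δ) : ENNReal)) ∧
    (∃ c : ℝ, 0 < c ∧ ∃ n₀ : ℕ, ∀ n ≥ n₀, ∀ A : Algorithm DFPCInput ℕ,
        SolvesDFPCWithin A (dfpcInstances q n) (p.eval n) (B * Real.log n) →
        ENNReal.ofReal (c * ((n : ℝ) / Real.log n) ^ (1 / 4 : ℝ)) ≤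
          (nodeActivationComplexity A (dfpcInstances q n) : ENNReal)) := by
  constructor
  · obtain ⟨n₀, hn₀⟩ := Filter.eventually_atTop.1 (eventually_information_le C B p)
    refine ⟨1 / 2, by norm_num, n₀, fun n hn Δ hΔ hΔC A hA => ?_⟩
    obtain ⟨h1, h2⟩ := hn₀ n hn Δ hΔC
    exact half_mul_le_nodeActivationComplexity (hq n) hΔ h1 h2 A hA
  · obtain ⟨n₀, hn₀⟩ := Filter.eventually_atTop.1 ((eventually_information_le 1 B p).and
      (tendsto_div_log_rpow.eventually_ge_atTop 2))
    refine ⟨1 / 4, by norm_num, n₀, fun n hn A hA => ?_⟩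
    obtain ⟨h, hy⟩ := hn₀ n hn
    set y := ((n : ℝ) / Real.log n) ^ (1 / 4 : ℝ)
    obtain ⟨h1, h2⟩ := h ⌊y⌋₊ (by rw [one_mul]; exact Nat.floor_le (by linarith))
    have hsub : dfpcInstancesOfMaxDegree q n ⌊y⌋₊ ⊆ dfpcInstances q n := fun I hI => hI.1
    have hfl : 2 ≤ ⌊y⌋₊ := Nat.le_floor (by exact_mod_cast hy)
    have hmain := half_mul_le_nodeActivationComplexity (hq n) hfl h1 h2 A
      ⟨fun I hI => hA.rounds I (hsub hI), fun I hI => hA.messages I (hsub hI),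
        fun I hI => hA.correct I (hsub hI)⟩
    refine le_trans (ENNReal.ofReal_le_ofReal ?_) (hmain.trans ?_)
    · have := Nat.lt_floor_add_one y
      linarith
    · exact ENat.toENNReal_le.2 (biSup_mono hsub)
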